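/- **Theorem (order conditions).** Consider autonomous problems $y'=f^{\{1\}}(y)+f^{\{2\}}(y)$ on $\mathbb{R}^N$ and $\varphi_k(z)=\sum_{i\ge0}z^i/(k+i)!$. *TPS-trees.* A TPS-tree is a non-empty unordered rooted tree whose nodes are round or square and have a colour $m\in\{1,2\}$, such that every square node has at most one child. $|\tau|$ is the number of nodes and $\gamma(\tau)$ is the density of the underlying uncoloured tree, $\gamma(\tau)=|\tau|\prod_i\gamma(\tau_i)$ over the subtrees $\tau_i$ of the root. Put $1/\gamma_S(\tau)=1/\gamma(\tau)$ for all $\tau$; put $1/\gamma_W(\tau)=1/\gamma(\tau)$ if all nodes of $\tau$ are round and $1/\gamma_W(\tau)=0$ otherwise. For the empty tree $\emptyset$, $|\emptyset|=0$ and $1/\gamma_S(\emptyset)=1/\gamma_W(\emptyset)=1$. *Methods of W-type.* These are given by arbitrary real coefficients and matrices $W^{\{1\}},W^{\{2\}}$. (PEXPW) For $q=1,2$ and $i=1,\dots,s^{\{q\}}$, $$u_i^{\{q\}}=y_n+\sum_{m=1}^2\sum_{j=1}^{\min(i-1,s^{\{m\}})}\alpha_{i,j}^{\{q,m\}}k_j^{\{m\}},$$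 $$k_i^{\{q\}}=\varphi_1\bigl(h\gamma_{i,i}^{\{q,q\}}W^{\{q\}}\bigr)\Bigl(hf^{\{q\}}(u_i^{\{q\}})+hW^{\{q\}}\sum_{m=1}^2\sum_{j=1}^{\min(i-1,s^{\{m\}})}\gamma_{i,j}^{\{q,m\}}k_j^{\{m\}}\Bigr),$$ $$y_{n+1}=y_n+\sum_{q=1}^2\sum_{i=1}^{s^{\{q\}}}b_i^{\{q\}}k_i^{\{q\}}.$$ (PEPIRKW) With $\Psi_{j}^{\{q,m\}}=\sum_{k=1}^{j}p_{j,k}^{\{q,m\}}\varphi_k$ and $Y_0^{\{q\}}=y_n$, $$Y_i^{\{q\}}=y_n+\sum_m a_{i,1}^{\{q,m\}}\Psi_{1}^{\{q,m\}}(hg_{i,1}^{\{q,m\}}W^{\{m\}})\,hf^{\{m\}}(y_n)+\sum_m\sum_{j=2}^{i}a_{i,j}^{\{q,m\}}\Psi_{j}^{\{q,m\}}(hg_{i,j}^{\{q,m\}}W^{\{m\}})\,h\Delta^{(j-1)}_{Y^{\{q\}}}f^{\{m\}}(y_n),$$ $$y_{n+1}=y_n+\sum_m b_{1}^{\{m\}}\Psi_{1}^{\{m,m\}}(hg_{s,1}^{\{m,m\}}W^{\{m\}})\,hf^{\{m\}}(y_n)+\sum_m\sum_{j=2}^{s}b_{j}^{\{m\}}\Psi_{j}^{\{m,m\}}(hg_{s,j}^{\{m,m\}}W^{\{m\}})\,h\Delta^{(j-1)}_{Y^{\{m\}}}f^{\{m\}}(y_n),\qquad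 s=s^{\{m\}},$$ where $\Delta^{(j)}_{Y^{\{r\}}}f(y_n)$ is the $j$-th forward difference at index $0$ of $i\mapsto f(Y_i^{\{r\}})$. The variant with $\Delta_{Y^{\{m\}}}$ in place of $\Delta_{Y^{\{q\}}}$ in the stages is included. *Methods of split-RHS type.* Here $f^{\{m\}}(y)=L^{\{m\}}y+\mathcal N^{\{m\}}(y)$ with matrices $L^{\{m\}}$. They are the following families with arbitrary real coefficients; below, $\Psi_j^{\{m\}}=\sum_{k=1}^{j}p^{\{m\}}_{j,k}\varphi_k$, the bracket $[c,i]$ stands for one formula with coefficients $c$ and stage index $i$, the stages are $Y_i=[a_i,i]$, and $y_{n+1}=[b,s]$. (PSEPIRK) $[c,i]=y_n+\sum_m c_1^{\{m\}}\Psi_1^{\{m\}}(hg_{i,1}^{\{m\}}L^{\{m\}})\,h\bigl(f^{\{1\}}+f^{\{2\}}\bigr)(y_n)+\sum_m\sum_{l=2}^i c_l^{\{m\}}\Psi_l^{\{m\}}(hg_{i,l}^{\{m\}}L^{\{m\}})\,h\Delta^{(l-1)}\bigl(\mathcal N^{\{m\}}+f^{\{m'\}}\bigr)(y_n)$, with $m'\neq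 m$ the other partition. (Partitioned sEPIRK) The PEPIRKW formulas with $L^{\{m\}}$ in place of $W^{\{m\}}$ and with all forward differences $\Delta_{Y^{\{m\}}}^{(j-1)}\mathcal N^{\{m\}}(y_n)$. (Additively partitioned sEPIRK) With $L=L^{\{1\}}+L^{\{2\}}$, $[c,i]=y_n+\sum_m c_1^{\{m\}}\Psi_1^{\{m\}}(hg_{i,1}^{\{m\}}L)\,hL^{\{m\}}y_n+\sum_m\sum_{j=1}^i c_j^{\{m\}}\Psi_j^{\{m\}}(hg_{i,j}^{\{m\}}L)\,h\Delta^{(j-1)}\mathcal N^{\{m\}}(y_n)$. *B-series of the numerical solution.* A coefficient map $\mathsf a$ on TPS-trees and $\emptyset$ stands for $B(\mathsf a,y)=\mathsf a(\emptyset)y+\sum_\tau\mathsf a(\tau)\frac{h^{|\tau|}}{\sigma(\tau)}F(\tau)(y)$, where $\sigma(\tau)$ is the order of the symmetry group of $\tau$ and $F(\tau)$ is its elementary differential: round nodes of colour $m$ represent $\phi^{\{m\}}=f^{\{m\}}$ (W) or $\mathcal N^{\{m\}}$ (split-RHS), square nodes represent the matrix $A^{\{m\}}=W^{\{m\}}$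 or $L^{\{m\}}$, and a square leaf represents $A^{\{m\}}y$. The coefficients $\mathsf y_{n+1}(\tau)$ are obtained by carrying out the formulas of the method on coefficient maps, where $y_n$ is $1$ at $\emptyset$ and $0$ at all trees, and - $h\phi^{\{m\}}(\mathsf a)$ has the value $\prod_i\mathsf a(\tau_i)$ at a tree with a round root of colour $m$ and subtrees $\tau_i$, and $0$ elsewhere; - $hA^{\{m\}}\mathsf a$ has the value $\mathsf a(\tau_1)$ at a tree with a square root of colour $m$ and subtree $\tau_1$ (possibly $\emptyset$), and $0$ elsewhere; - $\varphi_k(hg\sum_{m\in S}A^{\{m\}})\mathsf a$ has at $\tau$ the value $\sum_l\frac{g^l}{(k+l)!}\mathsf a(\tau_{(l)})$, over all $l\ge0$ for which $l$ square nodes with colours in $S$ can be removed successively from the root of $\tau$, leaving $\tau_{(l)}$. *Order.* A method of W-type has order $p$ if for all $N$, all smooth $f^{\{1\}},f^{\{2\}}$, all real matrices $W^{\{1\}},W^{\{2\}}$ and all exact solutions $y$ near $t_n$, one step of size $h$ from $y_n=y(t_n)$ satisfies $y_{n+1}-y(t_n+h)=O(h^{p+1})$ as $h\to0^+$. A method of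 split-RHS type has order $p$ if the same holds for all smooth $\mathcal N^{\{1\}},\mathcal N^{\{2\}}$ and all matrices $L^{\{1\}},L^{\{2\}}$. *Claim.* A W-type method has order $p$ only if $\mathsf y_{n+1}(\tau)=1/\gamma_W(\tau)$ for every TPS-tree $\tau$ (and $\tau=\emptyset$) with $|\tau|\le p$. A split-RHS method has order $p$ only if $\mathsf y_{n+1}(\tau)=1/\gamma_S(\tau)$ for every TPS-tree $\tau$ (and $\tau=\emptyset$) with $|\tau|\le p$. -/

import Mathlib

open scoped BigOperators Topology ContDiff Matrix
open Asymptotics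

/-! ### TPS-trees -/

/-- TPS-trees with two partitions `m : Fin 2`.  A round node of colour `m` carries any number of
subtrees; a square node of colour `m` carries at most one (`squareLeaf m` has none, `square m t`
has the single subtree `t`).  Subtrees are listed in some order; all functions of trees used below
do not depend on that order, so each unordered tree is represented by any of its listings.
The empty tree is not included; `Option TPSTree` is the set of trees together with it. -/
inductive TPSTree : Type
  | round (m : Fin 2) (subtrees : List TPSTree) : TPSTree
  | squareLeaf (m : Fin 2) : TPSTree
  | square (m : Fin 2) (subtree : TPSTree) : TPSTree

namespace TPSTree

/-- The order `|τ|`: the number of nodes. -/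
def order : TPSTree → ℕ
  | round _ ts => (ts.map order).sum + 1
  | squareLeaf _ => 1
  | square _ t => order t + 1

/-- The density `γ(τ)` of the underlying uncoloured tree: `|τ|` times the product of the densities
of the subtrees of the root. -/
def gamma : TPSTree → ℕ
  | round m ts => order (round m ts) * (ts.map gamma).prod
  | squareLeaf _ => 1
  | square m t => order (square m t) * gamma t

/-- All nodes of the tree are round. -/
def allRound : TPSTree → Bool
  | round _ ts => (ts.map allRound).all id
  | squareLeaf _ => false
  | square _ _ => false

end TPSTree

/-- The number of nodes of a tree, `0` for the empty tree `none`. -/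
def treeOrder : Option TPSTree → ℕ
  | none => 0
  | some t => t.order

/-- `R_S^{[l]}(τ)`: remove `l` square nodes with colours in `S` from the root of `τ`;
the outer `none` means that the removal is not possible. -/
def removeRoot (S : Finset (Fin 2)) : ℕ → Option TPSTree → Option (Option TPSTree)
  | 0, t => some t
  | l + 1, some (.square m t) => if m ∈ S then removeRoot S l (some t) else none
  | l + 1, some (.squareLeaf m) => if m ∈ S then removeRoot S l none else none
  | _ + 1, some (.round _ _) => none
  | _ + 1, none => none

/-- `1/γ_S(τ)`: the B-series coefficients of the exact solution for split-RHS methods. -/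
noncomputable def invGammaS : Option TPSTree → ℝ
  | none => 1
  | some t => 1 / (t.gamma : ℝ)

/-- `1/γ_W(τ)`: the B-series coefficients of the exact solution for W-methods; they vanish on
trees with a square node. -/
noncomputable def invGammaW : Option TPSTree → ℝ
  | none => 1
  | some t => if t.allRound then 1 / (t.gamma : ℝ) else 0

/-! ### The operations a method is composed of -/

/-- The operations from which one step of a partitioned exponential method is composed.  They are
instantiated twice below: on the state space `ℝ^N`, where they give the numerical solution, and on
B-series coefficients, where they give the B-series of the numerical solution. -/
structure StepOps (V : Type) where
  /-- the current solution `y_n` -/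
  yn : V
  /-- `hf m v` is `h φ^{m}(v)`, where `φ^{m}` is the function of the round nodes
  (`f^{m}` for W-methods, `N^{m}` for split-RHS methods) -/
  hf : Fin 2 → V → V
  /-- `hA m v` is `h A^{m} v`, where `A^{m}` is the matrix of the square nodes
  (`W^{m}` for W-methods, `L^{m}` for split-RHS methods) -/
  hA : Fin 2 → V → V
  /-- `phi k S g v` is `φ_k(h g ∑_{m ∈ S} A^{m}) v` -/
  phi : ℕ → Finset (Fin 2) → ℝ → V → V

/-- The matrix function `φ_k(Z) = ∑_{i ≥ 0} Z^i / (k + i)!`. -/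
noncomputable def phiMatrix {N : ℕ} (k : ℕ) (Z : Matrix (Fin N) (Fin N) ℝ) :
    Matrix (Fin N) (Fin N) ℝ :=
  ∑' i : ℕ, (1 / ((k + i).factorial : ℝ)) • Z ^ i

/-- The operations on the state space `ℝ^N`, for step size `h`, functions `f`, matrices `A` and
current solution `y`. -/
noncomputable def numericalOps {N : ℕ} (f : Fin 2 → (Fin N → ℝ) → (Fin N → ℝ))
    (A : Fin 2 → Matrix (Fin N) (Fin N) ℝ) (y : Fin N → ℝ) (h : ℝ) : StepOps (Fin N → ℝ) where
  yn := y
  hf m v := h • f m v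
  hA m v := h • (A m *ᵥ v)
  phi k S g v := phiMatrix k ((h * g) • ∑ m ∈ S, A m) *ᵥ v

/-- Coefficient maps `a` of B-series
`B(a, y) = a(∅) y + ∑_τ a(τ) h^{|τ|} / σ(τ) F(τ)(y)`, on the trees and the empty tree `none`. -/
abbrev BCoeff : Type := Option TPSTree → ℝ

namespace BCoeff

/-- The coefficients of `y_n` itself. -/
def current : BCoeff
  | none => 1
  | some _ => 0

/-- The coefficients of `h φ^{m}(B(a, y))`. -/
def applyFun (m : Fin 2) (a : BCoeff) : BCoeff
  | some (.round m' ts) => if m' = m then (ts.map fun t => a (some t)).prod else 0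
  | _ => 0

/-- The coefficients of `h A^{m} B(a, y)`. -/
def applyMatrix (m : Fin 2) (a : BCoeff) : BCoeff
  | some (.square m' t) => if m' = m then a (some t) else 0
  | some (.squareLeaf m') => if m' = m then a none else 0
  | _ => 0

/-- The coefficients of `φ_k(h g ∑_{m ∈ S} A^{m}) B(a, y)`: the sum of
`g^l / (k + l)! * a(R_S^{[l]}(τ))` over all `l` for which the removal is defined. -/
noncomputable def applyPhi (k : ℕ) (S : Finset (Fin 2)) (g : ℝ) (a : BCoeff) : BCoeff :=
  fun τ => ∑ l ∈ Finset.range (treeOrder τ + 1),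
    match removeRoot S l τ with
    | some τ' => g ^ l / ((k + l).factorial : ℝ) * a τ'
    | none => 0

end BCoeff

/-- The operations on B-series coefficients. -/
noncomputable def bseriesOps : StepOps BCoeff where
  yn := BCoeff.current
  hf := BCoeff.applyFun
  hA := BCoeff.applyMatrix
  phi := BCoeff.applyPhi

/-! ### Schemes, their B-series and their order -/

/-- One step of a method, as a formula in the operations. -/
abbrev Scheme : Type 1 := ∀ (V : Type) [AddCommGroup V] [Module ℝ V], StepOps V → V

namespace Scheme

/-- The numerical solution `y_{n+1}` after one step of size `h` from `y`. -/
noncomputable def numericalStep (Φ : Scheme) {N : ℕ} (f : Fin 2 → (Fin N → ℝ) → (Fin N → ℝ))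
    (A : Fin 2 → Matrix (Fin N) (Fin N) ℝ) (y : Fin N → ℝ) (h : ℝ) : Fin N → ℝ :=
  Φ (Fin N → ℝ) (numericalOps f A y h)

/-- The coefficients `y_{n+1}(τ)` of the B-series of the numerical solution: the formula of the
method is carried out on B-series coefficients, starting from those of `y_n`. -/
noncomputable def bseries (Φ : Scheme) : BCoeff :=
  Φ BCoeff bseriesOps

/-- Order `p` of a W-type method: for every smooth partitioned problem
`y' = f^{1}(y) + f^{2}(y)` on some `ℝ^N` and for arbitrary matrices `W^{1}`, `W^{2}`, the error
after one step from the exact solution is `O(h^{p+1})`. -/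
def HasOrderW (Φ : Scheme) (p : ℕ) : Prop :=
  ∀ (N : ℕ) (f : Fin 2 → (Fin N → ℝ) → (Fin N → ℝ)) (W : Fin 2 → Matrix (Fin N) (Fin N) ℝ)
    (tn : ℝ) (y : ℝ → Fin N → ℝ),
    (∀ m, ContDiff ℝ ∞ (f m)) →
    (∀ᶠ t in 𝓝 tn, HasDerivAt y (∑ m, f m (y t)) t) →
    (fun h : ℝ => Φ.numericalStep f W (y tn) h - y (tn + h))
      =O[𝓝[>] 0] (fun h : ℝ => h ^ (p + 1))

/-- Order `p` of a split-RHS method: for every partitioned problem `y' = f^{1}(y) + f^{2}(y)` on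
some `ℝ^N` that is split as `f^{m}(y) = L^{m} y + N^{m}(y)` with arbitrary matrices `L^{m}` and
smooth `N^{m}`, the error after one step from the exact solution is `O(h^{p+1})`. -/
def HasOrderS (Φ : Scheme) (p : ℕ) : Prop :=
  ∀ (N : ℕ) (L : Fin 2 → Matrix (Fin N) (Fin N) ℝ) (𝒩 : Fin 2 → (Fin N → ℝ) → (Fin N → ℝ))
    (tn : ℝ) (y : ℝ → Fin N → ℝ),
    (∀ m, ContDiff ℝ ∞ (𝒩 m)) →
    (∀ᶠ t in 𝓝 tn, HasDerivAt y (∑ m, (L m *ᵥ y t + 𝒩 m (y t))) t) →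
    (fun h : ℝ => Φ.numericalStep 𝒩 L (y tn) h - y (tn + h))
      =O[𝓝[>] 0] (fun h : ℝ => h ^ (p + 1))

end Scheme

/-! ### Building blocks of the formulas -/

section Formulas

variable {V : Type} [AddCommGroup V] [Module ℝ V]

/-- The stages of an explicit method.  `explicitStages x₀ step n` is the table of the stages of
index `0, …, n`: stage `0` is `x₀`, and stage `i ≥ 1` is `step i X`, where `X` is the table of the
stages of index less than `i`.  (Entries of index larger than `n` are unused.) -/
def explicitStages {X : Type} (x₀ : X) (step : ℕ → (ℕ → X) → X) : ℕ → ℕ → X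
  | 0 => fun _ => x₀
  | n + 1 => Function.update (explicitStages x₀ step n) (n + 1)
      (step (n + 1) (explicitStages x₀ step n))

/-- `Ψ(h g ∑_{m ∈ S} A^{m}) v` with `Ψ = Ψ_j = ∑_{k=1}^{j} p_{j,k} φ_k`. -/
def psi (o : StepOps V) (p : ℕ → ℕ → ℝ) (j : ℕ) (S : Finset (Fin 2)) (g : ℝ) (v : V) : V :=
  ∑ k ∈ Finset.Icc 1 j, p j k • o.phi k S g v

/-- The forward difference `Δ^{(j)} G(Y_0)` over the nodes `Y_0 = y_n, Y_1, Y_2, …`. -/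
def fwdDiffAt (j : ℕ) (G : V → V) (Y : ℕ → V) : V :=
  (fwdDiff (1 : ℕ))^[j] (fun i => G (Y i)) 0

/-- For split-RHS methods: `h f^{m}(v) = h L^{m} v + h N^{m}(v)`. -/
def hfFull (o : StepOps V) (m : Fin 2) (v : V) : V := o.hA m v + o.hf m v

end Formulas

/-! ### The methods of W-type -/

/-- The coefficients of a PEXPW method (indices of stages start at `1`). -/
structure PEXPW where
  /-- the numbers of stages `s^{q}` -/
  s : Fin 2 → ℕ
  /-- `α^{q,m}_{i,j}` -/
  α : Fin 2 → Fin 2 → ℕ → ℕ → ℝ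
  /-- `γ^{q,m}_{i,j}` -/
  γ : Fin 2 → Fin 2 → ℕ → ℕ → ℝ
  /-- `b^{q}_{i}` -/
  b : Fin 2 → ℕ → ℝ

/-- One step of a PEXPW method:
`u_i^{q} = y_n + ∑_m ∑_{j=1}^{min(i-1,s^{m})} α_{i,j}^{q,m} k_j^{m}`,
`k_i^{q} = φ_1(h γ_{i,i}^{q,q} W^{q})
  (h f^{q}(u_i^{q}) + h W^{q} ∑_m ∑_{j=1}^{min(i-1,s^{m})} γ_{i,j}^{q,m} k_j^{m})`,
`y_{n+1} = y_n + ∑_q ∑_{i=1}^{s^{q}} b_i^{q} k_i^{q}`. -/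
def PEXPW.scheme (M : PEXPW) : Scheme := fun V _ _ o =>
  let u (i : ℕ) (k : ℕ → Fin 2 → V) (q : Fin 2) : V :=
    o.yn + ∑ m, ∑ j ∈ Finset.Icc 1 (min (i - 1) (M.s m)), M.α q m i j • k j m
  let stage (i : ℕ) (k : ℕ → Fin 2 → V) (q : Fin 2) : V :=
    o.phi 1 {q} (M.γ q q i i)
      (o.hf q (u i k q)
        + o.hA q (∑ m, ∑ j ∈ Finset.Icc 1 (min (i - 1) (M.s m)), M.γ q m i j • k j m))
  let k (i : ℕ) : Fin 2 → V := explicitStages 0 stage i i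
  o.yn + ∑ q, ∑ i ∈ Finset.Icc 1 (M.s q), M.b q i • k i q

/-- The coefficients of a PEPIRKW method (indices of stages start at `1`). -/
structure PEPIRKW where
  /-- the numbers of stages `s^{q}` -/
  s : Fin 2 → ℕ
  /-- `a^{q,m}_{i,j}` -/
  a : Fin 2 → Fin 2 → ℕ → ℕ → ℝ
  /-- `g^{q,m}_{i,j}` -/
  g : Fin 2 → Fin 2 → ℕ → ℕ → ℝ
  /-- `p^{q,m}_{j,k}`, the coefficients of `Ψ^{q,m}_{i,j} = ∑_{k=1}^{j} p^{q,m}_{j,k} φ_k` -/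
  p : Fin 2 → Fin 2 → ℕ → ℕ → ℝ
  /-- `b^{m}_{j}` -/
  b : Fin 2 → ℕ → ℝ

/-- The formulas of a PEPIRKW method:
`Y_i^{q} = y_n + ∑_m a_{i,1}^{q,m} Ψ_{i,1}^{q,m}(h g_{i,1}^{q,m} W^{m}) h f^{m}(y_n)
  + ∑_m ∑_{j=2}^{i} a_{i,j}^{q,m} Ψ_{i,j}^{q,m}(h g_{i,j}^{q,m} W^{m}) h Δ_{Y^{r}}^{(j-1)} f^{m}(y_n)`,
`y_{n+1} = y_n + ∑_m b_1^{m} Ψ_{s,1}^{m,m}(h g_{s,1}^{m,m} W^{m}) h f^{m}(y_n)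
  + ∑_m ∑_{j=2}^{s} b_j^{m} Ψ_{s,j}^{m,m}(h g_{s,j}^{m,m} W^{m}) h Δ_{Y^{m}}^{(j-1)} f^{m}(y_n)`
with `s = s^{m}`, where `r` is the partition `nodes q m`.  An upper limit of the inner sum below `i`
is the case of vanishing coefficients `a_{i,j}^{q,m}`. -/
def PEPIRKW.schemeWith (M : PEPIRKW) (nodes : Fin 2 → Fin 2 → Fin 2) : Scheme := fun V _ _ o =>
  let stage (i : ℕ) (Y : ℕ → Fin 2 → V) (q : Fin 2) : V :=
    o.yn + ∑ m, M.a q m i 1 • psi o (M.p q m) 1 {m} (M.g q m i 1) (o.hf m o.yn)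
      + ∑ m, ∑ j ∈ Finset.Icc 2 i, M.a q m i j •
          psi o (M.p q m) j {m} (M.g q m i j) (fwdDiffAt (j - 1) (o.hf m)
            (fun l => Y l (nodes q m)))
  let Y (i : ℕ) : Fin 2 → V := explicitStages (fun _ => o.yn) stage i i
  o.yn + ∑ m, M.b m 1 • psi o (M.p m m) 1 {m} (M.g m m (M.s m) 1) (o.hf m o.yn)
    + ∑ m, ∑ j ∈ Finset.Icc 2 (M.s m), M.b m j •
        psi o (M.p m m) j {m} (M.g m m (M.s m) j) (fwdDiffAt (j - 1) (o.hf m) (fun l => Y l m))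

/-- One step of a PEPIRKW method: the forward differences in a stage of partition `q` are taken over
the stages of partition `q`. -/
def PEPIRKW.scheme (M : PEPIRKW) : Scheme := M.schemeWith fun q _ => q

/-- One step of the variant of a PEPIRKW method in which the forward differences of `f^{m}` are
taken over the stages of partition `m`, in all stages (as they are in the formula of `y_{n+1}`). -/
def PEPIRKW.schemeOwnNodes (M : PEPIRKW) : Scheme := M.schemeWith fun _ m => m

/-! ### The methods of split-RHS type -/

/-- The coefficients of a method that has one common set of stages: the additively partitioned
sEPIRK methods, whose matrix functions have the argument `L^{1} + L^{2}`, and the PSEPIRK methods,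
obtained by averaging two sEPIRK methods (indices of stages start at `1`; a hat or an upper index
distinguishes the two partitions). -/
structure ARKCoeffs where
  /-- the number of stages `s` -/
  s : ℕ
  /-- `a^{m}_{i,j}` -/
  a : Fin 2 → ℕ → ℕ → ℝ
  /-- `g^{m}_{i,j}` -/
  g : Fin 2 → ℕ → ℕ → ℝ
  /-- `p^{m}_{j,k}`, the coefficients of `Ψ^{m}_{i,j} = ∑_{k=1}^{j} p^{m}_{j,k} φ_k` -/
  p : Fin 2 → ℕ → ℕ → ℝ
  /-- `b^{m}_{j}` -/
  b : Fin 2 → ℕ → ℝ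

/-- One step of an additively partitioned sEPIRK method, with `L = L^{1} + L^{2}`:
`Y_i = y_n + ∑_m a_{i,1}^{m} Ψ_{i,1}^{m}(h g_{i,1}^{m} L) h L^{m} y_n
  + ∑_m ∑_{j=1}^{i} a_{i,j}^{m} Ψ_{i,j}^{m}(h g_{i,j}^{m} L) h Δ^{(j-1)} N^{m}(y_n)`,
`y_{n+1} = y_n + ∑_m b_1^{m} Ψ_{s,1}^{m}(h g_{s,1}^{m} L) h L^{m} y_n
  + ∑_m ∑_{j=1}^{s} b_j^{m} Ψ_{s,j}^{m}(h g_{s,j}^{m} L) h Δ^{(j-1)} N^{m}(y_n)`. -/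
def additiveSEPIRKScheme (M : ARKCoeffs) : Scheme := fun V _ _ o =>
  let stage (i : ℕ) (Y : ℕ → V) : V :=
    o.yn + ∑ m, M.a m i 1 • psi o (M.p m) 1 Finset.univ (M.g m i 1) (o.hA m o.yn)
      + ∑ m, ∑ j ∈ Finset.Icc 1 i, M.a m i j •
          psi o (M.p m) j Finset.univ (M.g m i j) (fwdDiffAt (j - 1) (o.hf m) Y)
  let Y (i : ℕ) : V := explicitStages o.yn stage i i
  o.yn + ∑ m, M.b m 1 • psi o (M.p m) 1 Finset.univ (M.g m M.s 1) (o.hA m o.yn)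
    + ∑ m, ∑ j ∈ Finset.Icc 1 M.s, M.b m j •
        psi o (M.p m) j Finset.univ (M.g m M.s j) (fwdDiffAt (j - 1) (o.hf m) Y)

/-- One step of a PSEPIRK method, with `F = f^{1} + f^{2}` and `m'` the other partition:
`Y_i = y_n + ∑_m a_{i,1}^{m} Ψ_{i,1}^{m}(h g_{i,1}^{m} L^{m}) h F(y_n)
  + ∑_m ∑_{l=2}^{i} a_{i,l}^{m} Ψ_{i,l}^{m}(h g_{i,l}^{m} L^{m}) h Δ^{(l-1)} (N^{m} + f^{m'})(y_n)`,
`y_{n+1} = y_n + ∑_m b_1^{m} Ψ_{s,1}^{m}(h g_{s,1}^{m} L^{m}) h F(y_n)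
  + ∑_m ∑_{l=2}^{s} b_l^{m} Ψ_{s,l}^{m}(h g_{s,l}^{m} L^{m}) h Δ^{(l-1)} (N^{m} + f^{m'})(y_n)`. -/
def averagedSEPIRKScheme (M : ARKCoeffs) : Scheme := fun V _ _ o =>
  let hF (v : V) : V := ∑ m, hfFull o m v
  let hrem (m : Fin 2) (v : V) : V := o.hf m v + hfFull o (1 - m) v
  let stage (i : ℕ) (Y : ℕ → V) : V :=
    o.yn + ∑ m, M.a m i 1 • psi o (M.p m) 1 {m} (M.g m i 1) (hF o.yn)
      + ∑ m, ∑ l ∈ Finset.Icc 2 i, M.a m i l •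
          psi o (M.p m) l {m} (M.g m i l) (fwdDiffAt (l - 1) (hrem m) Y)
  let Y (i : ℕ) : V := explicitStages o.yn stage i i
  o.yn + ∑ m, M.b m 1 • psi o (M.p m) 1 {m} (M.g m M.s 1) (hF o.yn)
    + ∑ m, ∑ l ∈ Finset.Icc 2 M.s, M.b m l •
        psi o (M.p m) l {m} (M.g m M.s l) (fwdDiffAt (l - 1) (hrem m) Y)

/-- One step of a partitioned sEPIRK method with separate stages for the two partitions.  It has
the same coefficients as a PEPIRKW method:
`Y_i^{q} = y_n + ∑_m a_{i,1}^{q,m} Ψ_{i,1}^{q,m}(h g_{i,1}^{q,m} L^{m}) h f^{m}(y_n)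
  + ∑_m ∑_{l=2}^{i} a_{i,l}^{q,m} Ψ_{i,l}^{q,m}(h g_{i,l}^{q,m} L^{m}) h Δ_{Y^{m}}^{(l-1)} N^{m}(y_n)`,
`y_{n+1} = y_n + ∑_m b_1^{m} Ψ_{s,1}^{m,m}(h g_{s,1}^{m,m} L^{m}) h f^{m}(y_n)
  + ∑_m ∑_{l=2}^{s} b_l^{m} Ψ_{s,l}^{m,m}(h g_{s,l}^{m,m} L^{m}) h Δ_{Y^{m}}^{(l-1)} N^{m}(y_n)`
with `s = s^{m}`.  An upper limit of the inner sum below `i` is the case of vanishing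
coefficients `a_{i,l}^{q,m}`. -/
def partitionedSEPIRKScheme (M : PEPIRKW) : Scheme := fun V _ _ o =>
  let stage (i : ℕ) (Y : ℕ → Fin 2 → V) (q : Fin 2) : V :=
    o.yn + ∑ m, M.a q m i 1 • psi o (M.p q m) 1 {m} (M.g q m i 1) (hfFull o m o.yn)
      + ∑ m, ∑ l ∈ Finset.Icc 2 i, M.a q m i l •
          psi o (M.p q m) l {m} (M.g q m i l) (fwdDiffAt (l - 1) (o.hf m) (fun r => Y r m))
  let Y (i : ℕ) : Fin 2 → V := explicitStages (fun _ => o.yn) stage i i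
  o.yn + ∑ m, M.b m 1 • psi o (M.p m m) 1 {m} (M.g m m (M.s m) 1) (hfFull o m o.yn)
    + ∑ m, ∑ l ∈ Finset.Icc 2 (M.s m), M.b m l •
        psi o (M.p m m) l {m} (M.g m m (M.s m) l) (fwdDiffAt (l - 1) (o.hf m) (fun r => Y r m))

/-! A single test problem for each tree isolates its order condition, with no expansion in
elementary differentials. Given a tree `τ`, take a finite set of trees containing `τ` and closed
under passing to the subtrees of the root, with one coordinate per tree (`exists_closed`). On this
space let the functions and matrices be the very rules by which `hφ` and `hA` act on coefficient
maps (`func`, `mat`). They are well defined there because a value at a tree uses only values at its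
subtrees.

The linear map `restrict e h`, which sends a coefficient map `a` to the vector of all `h^|τ| a(τ)`,
carries the B-series operations to the numerical operations of this problem (`intertwines`). A
method is a formula in these operations and linear combinations, hence commutes with such a map
(`Scheme.IsNatural`). So for `h ≠ 0` the `τ`-coordinate of the numerical solution is exactly `h^|τ|`
times the B-series coefficient (`numericalStep_eq`).

The exact solution through the same initial value has `τ`-coordinate `x^|τ|/γ(τ)`: the recursion for
the density is the differential equation, coordinate by coordinate. In the W case the matrices do
not enter the equation, and trees with a square node get `0`. The error at `τ` is therefore a
constant times `h^|τ|`, and it can be `O(h^{p+1})` with `|τ| ≤ p` only if the constant is zero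
(`bseries_eq_of_isBigO`). -/

/-! ### Schemes are natural in the operations -/

/-- The linear map `π` carries the operations `o` to the operations `o'`. -/
structure StepOps.Intertwines {V V' : Type} [AddCommGroup V] [Module ℝ V] [AddCommGroup V']
    [Module ℝ V'] (π : V →ₗ[ℝ] V') (o : StepOps V) (o' : StepOps V') : Prop where
  yn : π o.yn = o'.yn
  hf : ∀ m v, π (o.hf m v) = o'.hf m (π v)
  hA : ∀ m v, π (o.hA m v) = o'.hA m (π v)
  phi : ∀ k S g v, π (o.phi k S g v) = o'.phi k S g (π v)

/-- The formula of the scheme commutes with linear maps that intertwine the operations. -/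
def Scheme.IsNatural (Φ : Scheme) : Prop :=
  ∀ (V V' : Type) [AddCommGroup V] [Module ℝ V] [AddCommGroup V'] [Module ℝ V']
    (π : V →ₗ[ℝ] V') (o : StepOps V) (o' : StepOps V'),
    StepOps.Intertwines π o o' → π (Φ V o) = Φ V' o'

/-- A step reads the whole table of earlier stages, so the induction covers all entries at once. `F`
is an arbitrary map, so that pairs of stages, one per partition, can be transported componentwise.
-/
theorem map_explicitStages {X X' : Type} (F : X → X') {x₀ : X} {x₀' : X'}
    {step : ℕ → (ℕ → X) → X} {step' : ℕ → (ℕ → X') → X'} (h₀ : F x₀ = x₀')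
    (hstep : ∀ i Y, F (step i Y) = step' i (fun j => F (Y j))) (n i : ℕ) :
    F (explicitStages x₀ step n i) = explicitStages x₀' step' n i := by
  induction n generalizing i with
  | zero => exact h₀
  | succ n ih =>
    rcases eq_or_ne i (n + 1) with rfl | hi
    · simp only [explicitStages, Function.update_self, hstep, ih]
    · simp only [explicitStages, Function.update_of_ne hi, ih]

section Naturality

variable {V V' : Type} [AddCommGroup V] [Module ℝ V] [AddCommGroup V'] [Module ℝ V']
  {π : V →ₗ[ℝ] V'} {o : StepOps V} {o' : StepOps V'}

theorem map_iterate_fwdDiff (π : V →ₗ[ℝ] V') (j : ℕ) (u : ℕ → V) (n : ℕ) :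
    π ((fwdDiff (1 : ℕ))^[j] u n) = (fwdDiff (1 : ℕ))^[j] (fun i => π (u i)) n := by
  induction j generalizing u with
  | zero => rfl
  | succ j ih =>
    have h : (fun i => π (fwdDiff 1 u i)) = fwdDiff 1 fun i => π (u i) := by
      funext i
      simp [fwdDiff]
    simp only [Function.iterate_succ_apply, ih, h]

theorem map_fwdDiffAt (π : V →ₗ[ℝ] V') {G : V → V} {G' : V' → V'}
    (hG : ∀ v, π (G v) = G' (π v)) (j : ℕ) (Y : ℕ → V) :
    π (fwdDiffAt j G Y) = fwdDiffAt j G' (fun i => π (Y i)) := by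
  simp only [fwdDiffAt, map_iterate_fwdDiff, hG]

theorem StepOps.Intertwines.psi (H : StepOps.Intertwines π o o') (p : ℕ → ℕ → ℝ) (j : ℕ)
    (S : Finset (Fin 2)) (g : ℝ) (v : V) : π (psi o p j S g v) = _root_.psi o' p j S g (π v) := by
  simp only [_root_.psi, map_sum, map_smul, H.phi]

theorem StepOps.Intertwines.hfFull (H : StepOps.Intertwines π o o') (m : Fin 2) (v : V) :
    π (hfFull o m v) = _root_.hfFull o' m (π v) := by
  simp only [_root_.hfFull, map_add, H.hA, H.hf]

end Naturality

theorem PEXPW.isNatural (M : PEXPW) : M.scheme.IsNatural := by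
  intro V V' _ _ _ _ π o o' H
  simp only [PEXPW.scheme, map_add, map_sum, map_smul, H.yn]
  refine congrArg _ (Finset.sum_congr rfl fun q _ => Finset.sum_congr rfl fun i _ => ?_)
  -- After `π` has been moved through the outer sums, only its commutation with the stage recursion
  -- remains.
  refine congrArg _ (congrFun (map_explicitStages (fun x : Fin 2 → V => fun q => π (x q))
    (by funext; simp) (fun i Y => ?_) i i) q)
  funext q
  simp only [H.phi, map_add, map_sum, map_smul, H.yn, H.hf, H.hA]

theorem PEPIRKW.isNatural_schemeWith (M : PEPIRKW) (nodes : Fin 2 → Fin 2 → Fin 2) :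
    (M.schemeWith nodes).IsNatural := by
  intro V V' _ _ _ _ π o o' H
  simp only [PEPIRKW.schemeWith, map_add, map_sum, map_smul, H.yn, H.psi, H.hf,
    map_fwdDiffAt π (H.hf _)]
  refine congrArg _ (Finset.sum_congr rfl fun m _ => Finset.sum_congr rfl fun j _ => ?_)
  refine congrArg _ (congrArg _ (congrArg _ (funext fun l => ?_)))
  refine congrFun (map_explicitStages (fun x : Fin 2 → V => fun q => π (x q))
    (by funext; simp [H.yn]) (fun i Y => ?_) l l) m
  funext q
  simp only [map_add, map_sum, map_smul, H.yn, H.psi, H.hf, map_fwdDiffAt π (H.hf _)]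

theorem partitionedSEPIRKScheme_isNatural (M : PEPIRKW) :
    (partitionedSEPIRKScheme M).IsNatural := by
  intro V V' _ _ _ _ π o o' H
  simp only [partitionedSEPIRKScheme, map_add, map_sum, map_smul, H.yn, H.psi, H.hfFull,
    map_fwdDiffAt π (H.hf _)]
  refine congrArg _ (Finset.sum_congr rfl fun m _ => Finset.sum_congr rfl fun j _ => ?_)
  refine congrArg _ (congrArg _ (congrArg _ (funext fun l => ?_)))
  refine congrFun (map_explicitStages (fun x : Fin 2 → V => fun q => π (x q))
    (by funext; simp [H.yn]) (fun i Y => ?_) l l) m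
  funext q
  simp only [map_add, map_sum, map_smul, H.yn, H.psi, H.hfFull, map_fwdDiffAt π (H.hf _)]

theorem additiveSEPIRKScheme_isNatural (M : ARKCoeffs) :
    (additiveSEPIRKScheme M).IsNatural := by
  intro V V' _ _ _ _ π o o' H
  simp only [additiveSEPIRKScheme, map_add, map_sum, map_smul, H.yn, H.psi, H.hA,
    map_fwdDiffAt π (H.hf _)]
  refine congrArg _ (Finset.sum_congr rfl fun m _ => Finset.sum_congr rfl fun j _ => ?_)
  refine congrArg _ (congrArg _ (congrArg _ (funext fun l => ?_)))
  refine map_explicitStages π H.yn (fun i Y => ?_) l l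
  simp only [map_add, map_sum, map_smul, H.yn, H.psi, H.hA, map_fwdDiffAt π (H.hf _)]

theorem averagedSEPIRKScheme_isNatural (M : ARKCoeffs) :
    (averagedSEPIRKScheme M).IsNatural := by
  intro V V' _ _ _ _ π o o' H
  have hrem (m : Fin 2) (v : V) : π (o.hf m v + hfFull o (1 - m) v)
      = o'.hf m (π v) + hfFull o' (1 - m) (π v) := by
    rw [map_add, H.hf, H.hfFull]
  have hdiff (m : Fin 2) (j : ℕ) (Y : ℕ → V) :=
    map_fwdDiffAt π (G := fun v => o.hf m v + hfFull o (1 - m) v)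
      (G' := fun v => o'.hf m v + hfFull o' (1 - m) v) (hrem m) j Y
  simp only [averagedSEPIRKScheme, map_add, map_sum, map_smul, H.yn, H.psi, H.hfFull, hdiff]
  refine congrArg _ (Finset.sum_congr rfl fun m _ => Finset.sum_congr rfl fun j _ => ?_)
  refine congrArg _ (congrArg _ (congrArg _ (funext fun l => ?_)))
  refine map_explicitStages π H.yn (fun i Y => ?_) l l
  simp only [map_add, map_sum, map_smul, H.yn, H.psi, H.hfFull, hdiff]

/-! ### Coefficient maps -/

namespace TPSTree

/-- The subtrees of the root, where a square leaf has the empty tree below it. -/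
def children : Option TPSTree → List (Option TPSTree)
  | some (round _ ts) => ts.map some
  | some (square _ t) => [some t]
  | some (squareLeaf _) => [none]
  | none => []

theorem order_pos (t : TPSTree) : 0 < t.order := by
  cases t <;> simp [order]

theorem treeOrder_lt_of_mem_children {s t : Option TPSTree} (h : s ∈ children t) :
    treeOrder s < treeOrder t := by
  match t with
  | some (round m ts) =>
    simp only [children, List.mem_map] at h
    obtain ⟨u, hu, rfl⟩ := h
    have := List.single_le_sum (l := ts.map order) (by simp) u.order (List.mem_map_of_mem hu)
    simp only [treeOrder, order]
    omega
  | some (square m u) =>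
    simp only [children, List.mem_singleton] at h
    subst h
    simp [treeOrder, order]
  | some (squareLeaf m) =>
    simp only [children, List.mem_singleton] at h
    subst h
    simp [treeOrder, order]
  | none => simp [children] at h

open Classical in
/-- Every tree lies in a finite set of trees that contains the subtrees of its members. -/
theorem exists_finset_children_subset (t : Option TPSTree) :
    ∃ T : Finset (Option TPSTree), t ∈ T ∧ ∀ s ∈ T, ∀ u ∈ children s, u ∈ T := by
  induction hn : treeOrder t using Nat.strong_induction_on generalizing t with
  | _ n ih =>
    subst hn
    have key : ∀ u ∈ children t,
        ∃ T : Finset (Option TPSTree), u ∈ T ∧ ∀ s ∈ T, ∀ u ∈ children s, u ∈ T :=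
      fun u hu => ih _ (treeOrder_lt_of_mem_children hu) u rfl
    choose! T hT hT' using key
    refine ⟨insert t ((children t).toFinset.biUnion T), Finset.mem_insert_self _ _, ?_⟩
    intro s hs u hu
    refine Finset.mem_insert_of_mem (Finset.mem_biUnion.2 ?_)
    rcases Finset.mem_insert.1 hs with rfl | hs
    · exact ⟨u, List.mem_toFinset.2 hu, hT u hu⟩
    · obtain ⟨v, hv, hsv⟩ := Finset.mem_biUnion.1 hs
      exact ⟨v, hv, hT' v (List.mem_toFinset.1 hv) s hsv u hu⟩

end TPSTree

namespace BCoeff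

/-- The coefficients of the B-series with the step size `h` included. -/
def scale (h : ℝ) (a : BCoeff) : BCoeff := fun t => h ^ treeOrder t * a t

/-- This locality lets the operations descend to a finite set of trees that contains the subtrees of
its members. -/
theorem applyFun_congr (m : Fin 2) {a b : BCoeff} {t : Option TPSTree}
    (hab : ∀ s ∈ TPSTree.children t, a s = b s) : applyFun m a t = applyFun m b t := by
  match t with
  | some (.round m' ts) =>
    simp only [applyFun]
    congr 2
    refine List.map_congr_left fun t ht => hab _ ?_
    simpa [TPSTree.children] using ht
  | some (.square m' u) => rfl
  | some (.squareLeaf m') => rfl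
  | none => rfl

theorem applyMatrix_congr (m : Fin 2) {a b : BCoeff} {t : Option TPSTree}
    (hab : ∀ s ∈ TPSTree.children t, a s = b s) : applyMatrix m a t = applyMatrix m b t := by
  match t with
  | some (.round m' ts) => rfl
  | some (.square m' u) => simp only [applyMatrix, hab (some u) (by simp [TPSTree.children])]
  | some (.squareLeaf m') => simp only [applyMatrix, hab none (by simp [TPSTree.children])]
  | none => rfl

theorem prod_map_pow_mul (h : ℝ) (a : BCoeff) (ts : List TPSTree) :
    (ts.map fun t => h ^ t.order * a (some t)).prod
      = h ^ (ts.map TPSTree.order).sum * (ts.map fun t => a (some t)).prod := by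
  induction ts with
  | nil => simp
  | cons t ts ih =>
    simp only [List.map_cons, List.prod_cons, List.sum_cons, ih, pow_add]
    ring

/-- The subtrees contribute `h` to the power `|τ| - 1`; the extra factor `h` accounts for the root.
-/
theorem mul_applyFun_scale (h : ℝ) (m : Fin 2) (a : BCoeff) (t : Option TPSTree) :
    h * applyFun m (scale h a) t = scale h (applyFun m a) t := by
  match t with
  | some (.round m' ts) =>
    simp only [applyFun, scale, treeOrder, TPSTree.order, prod_map_pow_mul]
    split_ifs
    · ring
    · simp
  | some (.square m' u) => simp [applyFun, scale]
  | some (.squareLeaf m') => simp [applyFun, scale]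
  | none => simp [applyFun, scale]

theorem mul_applyMatrix_scale (h : ℝ) (m : Fin 2) (a : BCoeff) (t : Option TPSTree) :
    h * applyMatrix m (scale h a) t = scale h (applyMatrix m a) t := by
  match t with
  | some (.round m' ts) => simp [applyMatrix, scale]
  | some (.square m' u) =>
    simp only [applyMatrix, scale, treeOrder, TPSTree.order]
    split_ifs
    · ring
    · simp
  | some (.squareLeaf m') =>
    simp only [applyMatrix, scale, treeOrder, TPSTree.order]
    split_ifs
    · ring
    · simp
  | none => simp [applyMatrix, scale]

/-- `applyMatrix` as a linear map. -/
def applyMatrixₗ (m : Fin 2) : BCoeff →ₗ[ℝ] BCoeff where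
  toFun := applyMatrix m
  map_add' a b := by
    funext t
    match t with
    | some (.round m' ts) => simp [applyMatrix]
    | some (.square m' u) => by_cases h : m' = m <;> simp [applyMatrix, h]
    | some (.squareLeaf m') => by_cases h : m' = m <;> simp [applyMatrix, h]
    | none => simp [applyMatrix]
  map_smul' c a := by
    funext t
    match t with
    | some (.round m' ts) => simp [applyMatrix]
    | some (.square m' u) => by_cases h : m' = m <;> simp [applyMatrix, h]
    | some (.squareLeaf m') => by_cases h : m' = m <;> simp [applyMatrix, h]
    | none => simp [applyMatrix]

/-- Applying the sum over `S` once strips a square root with colour in `S` and gives zero at any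
other root. The removal formula for `φ_k` thus becomes a power series in one linear operator. -/
theorem pow_sum_applyMatrixₗ_apply (S : Finset (Fin 2)) (l : ℕ) (a : BCoeff)
    (t : Option TPSTree) :
    ((∑ m ∈ S, applyMatrixₗ m) ^ l) a t
      = match removeRoot S l t with
        | some t' => a t'
        | none => 0 := by
  induction l generalizing t with
  | zero => simp [removeRoot]
  | succ l ih =>
    rw [pow_succ', Module.End.mul_apply, LinearMap.sum_apply, Finset.sum_apply]
    set b := ((∑ m ∈ S, applyMatrixₗ m) ^ l) a
    change ∑ m ∈ S, applyMatrix m b t = _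
    match t with
    | some (.round m' ts) => simp [applyMatrix, removeRoot]
    | some (.square m' u) => by_cases h : m' ∈ S <;> simp [applyMatrix, removeRoot, h, ih]
    | some (.squareLeaf m') => by_cases h : m' ∈ S <;> simp [applyMatrix, removeRoot, h, ih]
    | none => simp [applyMatrix, removeRoot]

theorem removeRoot_eq_none (S : Finset (Fin 2)) {l : ℕ} {t : Option TPSTree}
    (h : treeOrder t < l) : removeRoot S l t = none := by
  induction l generalizing t with
  | zero => omega
  | succ l ih =>
    match t with
    | some (.round m' ts) => rfl
    | some (.square m' u) =>
      simp only [treeOrder, TPSTree.order] at h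
      simp only [removeRoot, ih (t := some u) (by simp only [treeOrder]; omega), ite_self]
    | some (.squareLeaf m') =>
      simp only [treeOrder, TPSTree.order] at h
      simp only [removeRoot, ih (t := none) (by simp only [treeOrder]; omega), ite_self]
    | none => rfl

theorem pow_sum_applyMatrixₗ_eq_zero (S : Finset (Fin 2)) {l : ℕ} (a : BCoeff)
    {t : Option TPSTree} (h : treeOrder t < l) : ((∑ m ∈ S, applyMatrixₗ m) ^ l) a t = 0 := by
  rw [pow_sum_applyMatrixₗ_apply, removeRoot_eq_none S h]

/-- Terms with `l > |τ|` vanish, since each removal costs a node; hence one cut-off `n` can serve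
all listed trees simultaneously. -/
theorem applyPhi_eq_sum (k : ℕ) (S : Finset (Fin 2)) (g : ℝ) (a : BCoeff) {t : Option TPSTree}
    {n : ℕ} (hn : treeOrder t < n) :
    applyPhi k S g a t = ∑ l ∈ Finset.range n,
      g ^ l / ((k + l).factorial : ℝ) * ((∑ m ∈ S, applyMatrixₗ m) ^ l) a t := by
  rw [← Finset.sum_subset (Finset.range_subset_range.2 (Nat.succ_le_of_lt hn))
    fun l _ hl => ?_]
  · refine Finset.sum_congr rfl fun l _ => ?_
    rw [pow_sum_applyMatrixₗ_apply]
    split <;> simp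
  · rw [pow_sum_applyMatrixₗ_eq_zero S a (by simpa [Nat.lt_succ_iff] using hl), mul_zero]

end BCoeff

/-! ### The problem whose solution lists the B-series coefficients -/

namespace CoeffProblem

variable {N : ℕ} (e : Fin N → Option TPSTree)

/-- The set of trees `e` lists each tree once, and with each tree its subtrees. -/
structure Closed : Prop where
  injective : Function.Injective e
  children_mem : ∀ i, ∀ s ∈ TPSTree.children (e i), s ∈ Set.range e

/-- The coefficient map that vanishes outside of the listed trees. -/
noncomputable def extend : (Fin N → ℝ) →ₗ[ℝ] BCoeff := Function.ExtendByZero.linearMap ℝ e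

/-- The values of the scaled coefficient map at the listed trees. -/
def restrict (h : ℝ) : BCoeff →ₗ[ℝ] (Fin N → ℝ) where
  toFun a i := BCoeff.scale h a (e i)
  map_add' a b := by
    funext i
    simp [BCoeff.scale, mul_add]
  map_smul' c a := by
    funext i
    simp [BCoeff.scale, mul_left_comm]

/-- The functions of the round nodes. -/
noncomputable def func (m : Fin 2) (v : Fin N → ℝ) : Fin N → ℝ :=
  fun i => BCoeff.applyFun m (extend e v) (e i)

/-- The matrices of the square nodes. -/
noncomputable def mat (m : Fin 2) : Matrix (Fin N) (Fin N) ℝ :=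
  LinearMap.toMatrix' ((LinearMap.funLeft ℝ ℝ e) ∘ₗ BCoeff.applyMatrixₗ m ∘ₗ extend e)

theorem mat_mulVec (m : Fin 2) (v : Fin N → ℝ) (i : Fin N) :
    (mat e m *ᵥ v) i = BCoeff.applyMatrix m (extend e v) (e i) := by
  rw [mat, LinearMap.toMatrix'_mulVec]
  rfl

/-- Each component is zero or a finite product of linear forms in `v`. -/
theorem contDiff_func (m : Fin 2) : ContDiff ℝ ∞ (func e m) := by
  rw [contDiff_pi]
  intro i
  have hext (t : Option TPSTree) : ContDiff ℝ ∞ fun v : Fin N → ℝ => extend e v t :=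
    (((LinearMap.proj t : BCoeff →ₗ[ℝ] ℝ) ∘ₗ extend e).toContinuousLinearMap).contDiff
  simp only [func]
  match e i with
  | some (.round m' ts) =>
    simp only [BCoeff.applyFun]
    split_ifs
    · induction ts with
      | nil => simpa using contDiff_const
      | cons t ts ih =>
        simp only [List.map_cons, List.prod_cons]
        exact (hext _).mul ih
    · exact contDiff_const
  | some (.square m' u) => exact contDiff_const
  | some (.squareLeaf m') => exact contDiff_const
  | none => exact contDiff_const

variable {e}

theorem extend_restrict (he : Closed e) (h : ℝ) (a : BCoeff) {t : Option TPSTree}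
    (ht : t ∈ Set.range e) : extend e (restrict e h a) t = BCoeff.scale h a t := by
  obtain ⟨i, rfl⟩ := ht
  exact he.injective.extend_apply _ _ i

theorem func_restrict (he : Closed e) (h : ℝ) (m : Fin 2) (a : BCoeff) (i : Fin N) :
    func e m (restrict e h a) i = BCoeff.applyFun m (BCoeff.scale h a) (e i) :=
  BCoeff.applyFun_congr m fun s hs => extend_restrict he h a (he.children_mem i s hs)

theorem mat_mulVec_restrict (he : Closed e) (h : ℝ) (m : Fin 2) (a : BCoeff) (i : Fin N) :
    (mat e m *ᵥ restrict e h a) i = BCoeff.applyMatrix m (BCoeff.scale h a) (e i) := by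
  rw [mat_mulVec]
  exact BCoeff.applyMatrix_congr m fun s hs => extend_restrict he h a (he.children_mem i s hs)

theorem smul_func_restrict (he : Closed e) (h : ℝ) (m : Fin 2) (a : BCoeff) :
    h • func e m (restrict e h a) = restrict e h (BCoeff.applyFun m a) := by
  funext i
  rw [Pi.smul_apply, func_restrict he, smul_eq_mul, BCoeff.mul_applyFun_scale]
  rfl

theorem smul_mat_mulVec_restrict (he : Closed e) (h : ℝ) (m : Fin 2) (a : BCoeff) :
    h • (mat e m *ᵥ restrict e h a) = restrict e h (BCoeff.applyMatrixₗ m a) := by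
  funext i
  rw [Pi.smul_apply, mat_mulVec_restrict he, smul_eq_mul, BCoeff.mul_applyMatrix_scale]
  rfl

/-- Each factor `h` is absorbed by the weight of the square node it adds, so only the powers of `g`
survive. -/
theorem pow_mulVec_restrict (he : Closed e) (h g : ℝ) (S : Finset (Fin 2)) (l : ℕ)
    (a : BCoeff) : ((h * g) • ∑ m ∈ S, mat e m) ^ l *ᵥ restrict e h a
      = restrict e h (g ^ l • ((∑ m ∈ S, BCoeff.applyMatrixₗ m) ^ l) a) := by
  induction l with
  | zero => simp
  | succ l ih =>
    rw [pow_succ', ← Matrix.mulVec_mulVec, ih, pow_succ' (∑ m ∈ S, BCoeff.applyMatrixₗ m),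
      Module.End.mul_apply, map_smul, Matrix.mulVec_smul, Matrix.smul_mulVec, Matrix.sum_mulVec,
      mul_comm h g, mul_smul, Finset.smul_sum]
    simp only [smul_mat_mulVec_restrict he]
    rw [← map_sum, ← LinearMap.sum_apply, smul_smul, pow_succ, map_smul]

theorem restrict_surjective (he : Closed e) {h : ℝ} (hh : h ≠ 0) :
    Function.Surjective (restrict e h) := by
  intro w
  refine ⟨BCoeff.scale h⁻¹ (extend e w), funext fun i => ?_⟩
  have : extend e w (e i) = w i := he.injective.extend_apply _ _ i
  simp [restrict, BCoeff.scale, this, hh]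

theorem phiMatrix_mulVec_restrict (he : Closed e) {h : ℝ} (hh : h ≠ 0) (k : ℕ)
    (S : Finset (Fin 2)) (g : ℝ) (a : BCoeff) :
    phiMatrix k ((h * g) • ∑ m ∈ S, mat e m) *ᵥ restrict e h a
      = restrict e h (BCoeff.applyPhi k S g a) := by
  set n := (Finset.univ.sup fun i => treeOrder (e i)) + 1 with hn
  have hlt (i : Fin N) : treeOrder (e i) < n :=
    Nat.lt_succ_of_le (Finset.le_sup (f := fun i => treeOrder (e i)) (Finset.mem_univ i))
  -- The matrix is nilpotent: no listed tree has `n` nodes to remove. This is checked on vectors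
  -- `restrict e h b`, which exhaust the space as `h ≠ 0`; the series for `φ_k` becomes a finite
  -- sum.
  have hnil (l : ℕ) (hl : l ∉ Finset.range n) : ((h * g) • ∑ m ∈ S, mat e m) ^ l = 0 := by
    refine Matrix.mulVec_injective (funext fun w => ?_)
    obtain ⟨b, rfl⟩ := restrict_surjective he hh w
    rw [pow_mulVec_restrict he, Matrix.zero_mulVec]
    funext i
    have := BCoeff.pow_sum_applyMatrixₗ_eq_zero S b
      ((hlt i).trans_le (not_lt.1 (by simpa using hl)))
    simp [restrict, BCoeff.scale, this]
  rw [phiMatrix, tsum_eq_sum (s := Finset.range n) fun l hl => by rw [hnil l hl, smul_zero],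
    Matrix.sum_mulVec]
  simp only [Matrix.smul_mulVec, pow_mulVec_restrict he]
  funext i
  simp only [restrict, LinearMap.coe_mk, AddHom.coe_mk, BCoeff.scale, Finset.sum_apply,
    Pi.smul_apply, smul_eq_mul, BCoeff.applyPhi_eq_sum k S g a (hlt i), Finset.mul_sum]
  refine Finset.sum_congr rfl fun l _ => ?_
  ring

/-- The initial value `restrict e 0 BCoeff.current` does not involve `h`: it is `1` at the empty
tree, by `0 ^ 0 = 1`, and `0` at all others. One fixed problem therefore serves every step size. -/
theorem intertwines (he : Closed e) {h : ℝ} (hh : h ≠ 0) :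
    StepOps.Intertwines (restrict e h) bseriesOps
      (numericalOps (func e) (mat e) (restrict e 0 BCoeff.current) h) where
  yn := by
    funext i
    rcases hi : e i with _ | t <;>
      simp [restrict, BCoeff.scale, bseriesOps, numericalOps, BCoeff.current, treeOrder, hi]
  hf m v := (smul_func_restrict he h m v).symm
  hA m v := (smul_mat_mulVec_restrict he h m v).symm
  phi k S g v := (phiMatrix_mulVec_restrict he hh k S g v).symm

theorem numericalStep_eq (he : Closed e) {Φ : Scheme} (hΦ : Φ.IsNatural) {h : ℝ} (hh : h ≠ 0) :
    Φ.numericalStep (func e) (mat e) (restrict e 0 BCoeff.current) h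
      = restrict e h Φ.bseries :=
  (hΦ _ _ _ _ _ (intertwines he hh)).symm

/-- At the empty tree the truncated exponent `0 - 1` is harmless, because the factor `treeOrder` is
zero. -/
theorem hasDerivAt_restrict (c : BCoeff) (x : ℝ) :
    HasDerivAt (fun x => restrict e x c)
      (fun i => x ^ (treeOrder (e i) - 1) * (treeOrder (e i) * c (e i))) x := by
  rw [hasDerivAt_pi]
  intro i
  exact ((hasDerivAt_pow (treeOrder (e i)) x).mul_const (c (e i))).congr_deriv (by ring)

/-- If `c` lists the coefficients of an exact solution and the error after one step is
`O(h^{p+1})`, then the coefficients of the numerical solution agree with `c` up to order `p`. -/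
theorem bseries_eq_of_isBigO (he : Closed e) {Φ : Scheme} (hΦ : Φ.IsNatural) {p : ℕ}
    {c : BCoeff}
    (hO : (fun h : ℝ => Φ.numericalStep (func e) (mat e) (restrict e 0 BCoeff.current) h
      - restrict e (0 + h) c) =O[𝓝[>] 0] fun h : ℝ => h ^ (p + 1))
    {i : Fin N} (hi : treeOrder (e i) ≤ p) : Φ.bseries (e i) = c (e i) := by
  have h₁ : (fun h : ℝ => h ^ treeOrder (e i) * (Φ.bseries (e i) - c (e i)))
      =O[𝓝[>] 0] fun h : ℝ => h ^ (p + 1) := by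
    refine (isBigO_pi.1 hO i).congr' ?_ Filter.EventuallyEq.rfl
    filter_upwards [self_mem_nhdsWithin] with h hh
    rw [numericalStep_eq he hΦ (ne_of_gt hh)]
    simp [restrict, BCoeff.scale, mul_sub]
  -- Division by `h^|τ|` leaves a constant bounded by a multiple of a power of `h` whose exponent is
  -- at least `1`, since `|τ| ≤ p`; such a constant is zero.
  have h₂ : (fun _ : ℝ => Φ.bseries (e i) - c (e i))
      =O[𝓝[>] 0] fun h : ℝ => h ^ (p + 1 - treeOrder (e i)) := by
    have := (isBigO_refl (fun h : ℝ => (h ^ treeOrder (e i))⁻¹) (𝓝[>] 0)).mul h₁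
    refine this.congr' ?_ ?_ <;> filter_upwards [self_mem_nhdsWithin] with h hh
    · exact inv_mul_cancel_left₀ (pow_ne_zero _ (ne_of_gt hh)) _
    · rw [pow_sub₀ h (ne_of_gt hh) (by omega), mul_comm]
  have h₃ : Filter.Tendsto (fun h : ℝ => h ^ (p + 1 - treeOrder (e i))) (𝓝[>] 0) (𝓝 0) := by
    have : Filter.Tendsto (fun h : ℝ => h ^ (p + 1 - treeOrder (e i))) (𝓝 0)
        (𝓝 (0 ^ (p + 1 - treeOrder (e i)))) := (continuous_pow _).tendsto 0
    rw [zero_pow (by omega)] at this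
    exact this.mono_left nhdsWithin_le_nhds
  exact sub_eq_zero.1 (tendsto_nhds_unique tendsto_const_nhds (h₂.trans_tendsto h₃))

theorem restrict_zero_eq_current {c : BCoeff} (hc : c none = 1) :
    restrict e 0 c = restrict e 0 BCoeff.current := by
  funext i
  rcases hi : e i with _ | t
  · simp [restrict, BCoeff.scale, BCoeff.current, hi, hc]
  · simp [restrict, BCoeff.scale, BCoeff.current, hi, treeOrder, t.order_pos.ne']

theorem exists_closed (t : Option TPSTree) :
    ∃ (N : ℕ) (e : Fin N → Option TPSTree), Closed e ∧ t ∈ Set.range e := by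
  obtain ⟨T, ht, hT⟩ := TPSTree.exists_finset_children_subset t
  have hrange : ∀ s ∈ T, s ∈ Set.range fun i => (T.equivFin.symm i : Option TPSTree) :=
    fun s hs => ⟨T.equivFin ⟨s, hs⟩, by simp⟩
  exact ⟨T.card, fun i => T.equivFin.symm i,
    ⟨Subtype.val_injective.comp T.equivFin.symm.injective,
      fun i s hs => hrange s (hT _ (T.equivFin.symm i).2 s hs)⟩, hrange t ht⟩

end CoeffProblem

/-! ### The coefficients of the exact solution -/

theorem inv_prod_gamma (ts : List TPSTree) :
    (((ts.map TPSTree.gamma).prod : ℕ) : ℝ)⁻¹ = (ts.map fun t => invGammaS (some t)).prod := by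
  induction ts with
  | nil => simp
  | cons t ts ih =>
    rw [List.map_cons, List.prod_cons, Nat.cast_mul, mul_inv, ih, List.map_cons, List.prod_cons,
      invGammaS, one_div]

/-- Differentiating `x^|τ|/γ(τ)` produces the factor `|τ|`, which cancels the one in the density and
leaves the product over the subtrees. -/
theorem order_mul_invGammaS_round (m : Fin 2) (ts : List TPSTree) :
    ((TPSTree.round m ts).order : ℝ) * invGammaS (some (.round m ts))
      = (ts.map fun t => invGammaS (some t)).prod := by
  have := (TPSTree.round m ts).order_pos.ne'
  rw [← inv_prod_gamma, invGammaS, TPSTree.gamma, Nat.cast_mul]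
  field_simp

theorem order_mul_invGammaS_square (m : Fin 2) (t : TPSTree) :
    ((TPSTree.square m t).order : ℝ) * invGammaS (some (.square m t)) = invGammaS (some t) := by
  have := (TPSTree.square m t).order_pos.ne'
  rw [invGammaS, TPSTree.gamma, Nat.cast_mul, invGammaS]
  field_simp

/-- A square node in any one subtree makes its factor, and so the product, vanish. -/
theorem prod_invGammaW (ts : List TPSTree) :
    (ts.map fun t => invGammaW (some t)).prod
      = if (ts.map TPSTree.allRound).all id then (ts.map fun t => invGammaS (some t)).prod
        else 0 := by
  induction ts with
  | nil => simp
  | cons t ts ih =>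
    simp only [List.map_cons, List.prod_cons, List.all_cons, ih, id]
    by_cases h : t.allRound <;> simp [invGammaW, invGammaS, h]

theorem order_mul_invGammaW_round (m : Fin 2) (ts : List TPSTree) :
    ((TPSTree.round m ts).order : ℝ) * invGammaW (some (.round m ts))
      = (ts.map fun t => invGammaW (some t)).prod := by
  rw [prod_invGammaW, ← order_mul_invGammaS_round m, invGammaW, TPSTree.allRound, invGammaS,
    mul_ite, mul_zero]

theorem sum_applyFun_scale_round (x : ℝ) (c : BCoeff) (m : Fin 2) (ts : List TPSTree) :
    ∑ m', BCoeff.applyFun m' (BCoeff.scale x c) (some (.round m ts))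
      = x ^ ((TPSTree.round m ts).order - 1) * (ts.map fun t => c (some t)).prod := by
  simp only [BCoeff.applyFun, BCoeff.scale, treeOrder, TPSTree.order, BCoeff.prod_map_pow_mul,
    Finset.sum_ite_eq, Finset.mem_univ, if_true, Nat.add_sub_cancel]

/-- This is the differential equation `y' = f^{1}(y) + f^{2}(y)` of the test problem. At a square
root both sides are zero: no function acts there and `invGammaW` vanishes. -/
theorem sum_applyFun_scale_invGammaW (x : ℝ) (t : Option TPSTree) :
    ∑ m, BCoeff.applyFun m (BCoeff.scale x invGammaW) t
      = x ^ (treeOrder t - 1) * (treeOrder t * invGammaW t) := by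
  match t with
  | some (.round m ts) =>
    rw [sum_applyFun_scale_round, treeOrder, order_mul_invGammaW_round]
  | some (.square m u) => simp [BCoeff.applyFun, invGammaW, TPSTree.allRound]
  | some (.squareLeaf m) => simp [BCoeff.applyFun, invGammaW, TPSTree.allRound]
  | none => simp [BCoeff.applyFun, treeOrder]

/-- Here the matrices are part of the right-hand side, so a square root obeys the same density
recursion as a round one. Exactly one of the four terms can be nonzero, selected by the shape and
colour of the root. -/
theorem sum_apply_scale_invGammaS (x : ℝ) (t : Option TPSTree) :
    ∑ m, (BCoeff.applyMatrix m (BCoeff.scale x invGammaS) t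
        + BCoeff.applyFun m (BCoeff.scale x invGammaS) t)
      = x ^ (treeOrder t - 1) * (treeOrder t * invGammaS t) := by
  rw [Finset.sum_add_distrib]
  match t with
  | some (.round m ts) =>
    rw [sum_applyFun_scale_round, treeOrder, order_mul_invGammaS_round]
    simp [BCoeff.applyMatrix]
  | some (.square m u) =>
    rw [treeOrder, order_mul_invGammaS_square]
    simp [BCoeff.applyMatrix, BCoeff.applyFun, BCoeff.scale, treeOrder, TPSTree.order]
  | some (.squareLeaf m) =>
    simp [BCoeff.applyMatrix, BCoeff.applyFun, BCoeff.scale, treeOrder, TPSTree.order,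
      invGammaS, TPSTree.gamma]
  | none => simp [BCoeff.applyFun, BCoeff.applyMatrix, treeOrder]

/-! ### The order conditions -/

open CoeffProblem

theorem Scheme.IsNatural.bseries_eq_invGammaW {Φ : Scheme} (hΦ : Φ.IsNatural) {p : ℕ}
    (hp : Φ.HasOrderW p) (τ : Option TPSTree) (hτ : treeOrder τ ≤ p) :
    Φ.bseries τ = invGammaW τ := by
  obtain ⟨N, e, he, i, rfl⟩ := exists_closed τ
  -- The matrices of the test problem serve as `W`; they affect the numerical step but not the exact
  -- solution.
  have hO := hp N (func e) (mat e) 0 (fun x => restrict e x invGammaW) (contDiff_func e)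
    (Filter.Eventually.of_forall fun x => ?_)
  · rw [restrict_zero_eq_current rfl] at hO
    exact bseries_eq_of_isBigO he hΦ hO hτ
  · convert hasDerivAt_restrict (e := e) invGammaW x using 1
    funext j
    rw [Finset.sum_apply, ← sum_applyFun_scale_invGammaW]
    simp only [func_restrict he]

theorem Scheme.IsNatural.bseries_eq_invGammaS {Φ : Scheme} (hΦ : Φ.IsNatural) {p : ℕ}
    (hp : Φ.HasOrderS p) (τ : Option TPSTree) (hτ : treeOrder τ ≤ p) :
    Φ.bseries τ = invGammaS τ := by
  obtain ⟨N, e, he, i, rfl⟩ := exists_closed τ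
  have hO := hp N (mat e) (func e) 0 (fun x => restrict e x invGammaS) (contDiff_func e)
    (Filter.Eventually.of_forall fun x => ?_)
  · rw [restrict_zero_eq_current rfl] at hO
    exact bseries_eq_of_isBigO he hΦ hO hτ
  · convert hasDerivAt_restrict (e := e) invGammaS x using 1
    funext j
    rw [Finset.sum_apply, ← sum_apply_scale_invGammaS]
    simp only [Pi.add_apply, mat_mulVec_restrict he, func_restrict he]

theorem theorem1 (p : ℕ) :
    -- methods of W-type
    (∀ M : PEXPW, M.scheme.HasOrderW p →
      ∀ τ : Option TPSTree, treeOrder τ ≤ p → M.scheme.bseries τ = invGammaW τ) ∧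
    (∀ M : PEPIRKW, M.scheme.HasOrderW p →
      ∀ τ : Option TPSTree, treeOrder τ ≤ p → M.scheme.bseries τ = invGammaW τ) ∧
    (∀ M : PEPIRKW, M.schemeOwnNodes.HasOrderW p →
      ∀ τ : Option TPSTree, treeOrder τ ≤ p → M.schemeOwnNodes.bseries τ = invGammaW τ) ∧
    -- methods of split-RHS type
    (∀ M : ARKCoeffs, (averagedSEPIRKScheme M).HasOrderS p →
      ∀ τ : Option TPSTree, treeOrder τ ≤ p →
        (averagedSEPIRKScheme M).bseries τ = invGammaS τ) ∧
    (∀ M : PEPIRKW, (partitionedSEPIRKScheme M).HasOrderS p →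
      ∀ τ : Option TPSTree, treeOrder τ ≤ p →
        (partitionedSEPIRKScheme M).bseries τ = invGammaS τ) ∧
    (∀ M : ARKCoeffs, (additiveSEPIRKScheme M).HasOrderS p →
      ∀ τ : Option TPSTree, treeOrder τ ≤ p →
        (additiveSEPIRKScheme M).bseries τ = invGammaS τ) := by
  exact ⟨fun M => M.isNatural.bseries_eq_invGammaW,
    fun M => (M.isNatural_schemeWith _).bseries_eq_invGammaW,
    fun M => (M.isNatural_schemeWith _).bseries_eq_invGammaW,
    fun M => (averagedSEPIRKScheme_isNatural M).bseries_eq_invGammaS,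
    fun M => (partitionedSEPIRKScheme_isNatural M).bseries_eq_invGammaS,
    fun M => (additiveSEPIRKScheme_isNatural M).bseries_eq_invGammaS⟩
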